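/- Let $n\ge 4$ and let $P_n$ be the path with $n$ vertices. For a finite simple graph $G$ with vertex set $V$, let $$\mathbf X_G=\sum_{\kappa}\prod_{v\in V}x_{\kappa(v)}\in\mathbb Q[[x_0,x_1,x_2,\dots]]$$ be its chromatic symmetric function, where $\kappa$ runs over all proper colorings $\kappa:V\to\mathbb N$ of $G$. For $k\ge 1$ let $\mathfrak{st}_k=\mathbf X_{\mathsf{St}_k}$, where $\mathsf{St}_k$ is the star graph on $k$ vertices (one central vertex joined to the $k-1$ other vertices, with no further edges), and for a partition $\lambda=(\lambda_1,\dots,\lambda_\ell)$ let $\mathfrak{st}_\lambda=\mathfrak{st}_{\lambda_1}\cdots\mathfrak{st}_{\lambda_\ell}$. Let $\ell(\lambda)$ be the number of parts of $\lambda$ and $m_i=m_i(\lambda)$ the number of parts of $\lambda$ equal to $i$. Then $$\mathbf X_{P_n}=\sum_{\lambda\vdash n}(-1)^{m_1}\binom{m_2+\dots+m_n}{m_2,\dots,m_n}\binom{n-2-\ell(\lambda)+m_1}{m_1}\,\mathfrak{st}_\lambda ,$$ where the sum is over all partitions $\lambda=(1^{m_1}2^{m_2}\cdots n^{m_n})$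 of $n$. -/

import Mathlib

namespace ChromaticSymm

/-- Formal power series over `ℚ` in countably many commuting variables `x_i`, `i : ℕ`. -/
abbrev Series : Type := MvPowerSeries ℕ ℚ

/-- The monomial `∏_v x_{κ(v)}` attached to a colouring `κ`. -/
noncomputable def colorMonomial {V : Type*} [Fintype V] (κ : V → ℕ) : Series :=
  ∏ v : V, MvPowerSeries.X (κ v)

/-- The chromatic symmetric function `X_G = ∑_κ ∏_v x_{κ(v)}`, the sum over all proper colourings
`κ : V → ℕ` of the finite graph `G`. The infinite formal sum is taken coefficient by coefficient;
only finitely many `κ` contribute to a given coefficient (`finite_support_coeff`). -/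
noncomputable def csf {V : Type*} [Fintype V] (G : SimpleGraph V) : Series :=
  fun d : ℕ →₀ ℕ => ∑ᶠ κ : G.Coloring ℕ, MvPowerSeries.coeff d (colorMonomial κ)

theorem colorMonomial_eq {V : Type*} [Fintype V] (κ : V → ℕ) :
    colorMonomial κ = MvPowerSeries.monomial (∑ v : V, Finsupp.single (κ v) 1) (1 : ℚ) := by
  classical
  unfold colorMonomial
  induction (Finset.univ : Finset V) using Finset.induction_on with
  | empty => simp
  | insert a s ha ih =>
    rw [Finset.prod_insert ha, Finset.sum_insert ha, ih, MvPowerSeries.X_def,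
      MvPowerSeries.monomial_mul_monomial, one_mul]

/-- The sum that defines a coefficient of `csf G` is a finite one. -/
theorem finite_support_coeff {V : Type*} [Fintype V] (G : SimpleGraph V) (d : ℕ →₀ ℕ) :
    (Function.support fun κ : G.Coloring ℕ =>
      MvPowerSeries.coeff d (colorMonomial κ)).Finite := by
  classical
  have hfin : {f : V → ℕ | ∀ v, f v ∈ d.support}.Finite := by
    have h := Set.Finite.pi' (ι := V) (t := fun _ => (d.support : Set ℕ))
      (fun _ => d.support.finite_toSet)
    simpa using h
  refine Set.Finite.of_finite_image (f := fun κ : G.Coloring ℕ => (κ : V → ℕ))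
    (hfin.subset ?_) (fun a _ b _ h => DFunLike.coe_injective h)
  rintro _ ⟨κ, hκ, rfl⟩ v
  have hd : d = ∑ v : V, Finsupp.single (κ v) 1 := by
    by_contra hne
    apply hκ
    change MvPowerSeries.coeff d (colorMonomial κ) = 0
    rw [colorMonomial_eq, MvPowerSeries.coeff_monomial, if_neg hne]
  have h1 : (1 : ℕ) ≤ d (κ v) := by
    rw [hd, Finsupp.finsetSum_apply]
    refine le_trans ?_ (Finset.single_le_sum (fun _ _ => Nat.zero_le _) (Finset.mem_univ v))
    simp
  exact Finsupp.mem_support_iff.mpr (Nat.one_le_iff_ne_zero.mp h1)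

/-- `𝔰𝔱_k`, the chromatic symmetric function of the star graph on `k` vertices
(one central vertex adjacent to the other `k - 1`); for `k = 0` this is the empty product. -/
noncomputable def starCsf : ℕ → Series
  | 0 => 1
  | k + 1 => csf (SimpleGraph.starGraph (0 : Fin (k + 1)))

/-- `𝔰𝔱_λ = 𝔰𝔱_{λ₁} 𝔰𝔱_{λ₂} ⋯ 𝔰𝔱_{λ_ℓ}`. -/
noncomputable def starBasis {n : ℕ} (p : n.Partition) : Series :=
  (p.parts.map starCsf).prod

/-- `m_i`, the number of parts of the partition equal to `i`. -/
def mult {n : ℕ} (p : n.Partition) (i : ℕ) : ℕ := p.parts.count i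

/-- `ℓ(λ)`, the number of parts. -/
def len {n : ℕ} (p : n.Partition) : ℕ := Multiset.card p.parts

/-- The upper entry of the binomial coefficient in the path expansion involves no truncated
subtraction: `n - 2 - ℓ(λ) + m₁ ≥ 0` whenever `n ≥ 4`. -/
theorem len_add_two_le {n : ℕ} (hn : 4 ≤ n) (p : n.Partition) :
    len p + 2 ≤ n + mult p 1 := by
  have key : ∀ s : Multiset ℕ, (∀ i ∈ s, 0 < i) →
      2 * Multiset.card s ≤ s.sum + s.count 1 := by
    intro s
    induction s using Multiset.induction_on with
    | empty => simp
    | cons a s ih =>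
      intro h
      have h1 := ih (fun i hi => h i (Multiset.mem_cons_of_mem hi))
      have h2 := h a (Multiset.mem_cons_self a s)
      rw [Multiset.card_cons, Multiset.sum_cons, Multiset.count_cons]
      split_ifs <;> omega
  have h := key p.parts (fun i hi => p.parts_pos hi)
  have h3 : p.parts.count 1 ≤ Multiset.card p.parts := Multiset.count_le_card _ _
  rw [p.parts_sum] at h
  unfold len mult
  omega

end ChromaticSymm

namespace ChromaticSymm

open Finset

/-- The predicate that `κ` is a proper colouring of `G`. -/
def IsProper {V C : Type*} (G : SimpleGraph V) (κ : V → C) : Prop :=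
  ∀ a b, G.Adj a b → κ a ≠ κ b

open Classical in
/-- The sum `∑_κ ∏_v x_{κ(v)}` over proper colourings with colours in a finite type. -/
noncomputable def colorSum {V C R : Type*} [Fintype V] [DecidableEq V] [Fintype C] [CommRing R]
    (G : SimpleGraph V) (x : C → R) : R :=
  ∑ κ : V → C, if IsProper G κ then ∏ v, x (κ v) else 0

/-- Series all of whose coefficients at monomials in `x_0, …, x_{N-1}` vanish. -/
def tailIdeal (N : ℕ) : Ideal Series where
  carrier := {f | ∀ d : ℕ →₀ ℕ, d.support ⊆ range N → MvPowerSeries.coeff d f = 0}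
  add_mem' := by
    intro a b ha hb d hd
    rw [map_add, ha d hd, hb d hd, add_zero]
  zero_mem' := by
    intro d _
    simp
  smul_mem' := by
    classical
    intro c f hf d hd
    rw [smul_eq_mul, MvPowerSeries.coeff_mul]
    refine Finset.sum_eq_zero fun p hp => ?_
    rw [Finset.HasAntidiagonal.mem_antidiagonal] at hp
    rw [hf p.2, mul_zero]
    refine fun i hi => hd ?_
    rw [Finsupp.mem_support_iff] at hi ⊢
    rw [← hp, Finsupp.add_apply]
    omega

theorem eq_of_sub_mem_tailIdeal {f g : Series} (h : ∀ N, f - g ∈ tailIdeal N) : f = g := by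
  ext d
  have := h (d.support.sup id + 1) d (fun i hi => by
    rw [mem_range]
    exact Nat.lt_succ_of_le (Finset.le_sup (f := id) hi))
  rwa [map_sub, sub_eq_zero] at this

theorem csf_sub_colorSum_mem {V : Type*} [Fintype V] [DecidableEq V] (G : SimpleGraph V) (N : ℕ) :
    csf G - colorSum G (fun i : Fin N => (MvPowerSeries.X (i : ℕ) : Series)) ∈ tailIdeal N := by
  classical
  intro d hd
  rw [map_sub, sub_eq_zero]
  let S := {κ : V → Fin N // IsProper G κ}
  let e : S → G.Coloring ℕ := fun κ => SimpleGraph.Coloring.mk (fun v => (κ.1 v : ℕ))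
    (fun {a b} hab h => κ.2 a b hab (Fin.ext h))
  have he : Function.Injective e := by
    intro κ κ' h
    apply Subtype.ext
    funext v
    exact Fin.ext (congrArg (fun f : G.Coloring ℕ => f v) h)
  change (∑ᶠ κ : G.Coloring ℕ, MvPowerSeries.coeff d (colorMonomial κ)) = _
  rw [finsum_eq_sum_of_support_subset (s := univ.image e), sum_image he.injOn]
  · unfold colorSum
    rw [← sum_filter, map_sum]
    exact (Finset.sum_subtype (p := IsProper G) _ (fun κ => by simp)
      (fun κ : V → Fin N => MvPowerSeries.coeff d (∏ v, MvPowerSeries.X (κ v : ℕ)))).symm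
  · intro κ hκ
    have hlt : ∀ v, κ v < N := by
      intro v
      have hd' : d = ∑ v : V, Finsupp.single (κ v) 1 := by
        by_contra hne
        apply hκ
        change MvPowerSeries.coeff d (colorMonomial κ) = 0
        rw [colorMonomial_eq, MvPowerSeries.coeff_monomial, if_neg hne]
      rw [← mem_range]
      apply hd
      have h1 : (1 : ℕ) ≤ d (κ v) := by
        rw [hd', Finsupp.finsetSum_apply]
        refine le_trans ?_ (Finset.single_le_sum (fun _ _ => Nat.zero_le _) (Finset.mem_univ v))
        simp
      exact Finsupp.mem_support_iff.mpr (Nat.one_le_iff_ne_zero.mp h1)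
    rw [coe_image, coe_univ, Set.image_univ]
    refine ⟨⟨fun v => ⟨κ v, hlt v⟩, fun a b hab h => κ.valid hab (congrArg Fin.val h)⟩, ?_⟩
    apply DFunLike.ext
    intro v
    rfl

section FiniteColours

variable {C R : Type*} [Fintype C] [CommRing R]

theorem sum_fin_succ_fun (n : ℕ) (f : (Fin (n + 1) → C) → R) :
    ∑ κ, f κ = ∑ c, ∑ κ : Fin n → C, f (Fin.cons c κ) := by
  rw [← Fintype.sum_prod_type']
  exact (Fintype.sum_equiv (Fin.consEquiv (fun _ => C)) _ _ (fun _ => rfl)).symm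

theorem colorSum_starGraph (x : C → R) (k : ℕ) :
    colorSum (SimpleGraph.starGraph (0 : Fin (k + 1))) x =
      ∑ c, x c * ((∑ c, x c) - x c) ^ k := by
  classical
  unfold colorSum
  rw [sum_fin_succ_fun]
  refine Finset.sum_congr rfl fun c _ => ?_
  have h1 : (∑ c, x c) - x c = ∑ c', if c' ≠ c then x c' else 0 := by
    rw [← Finset.sum_filter, Finset.filter_ne', ← Finset.sum_erase_add _ _ (mem_univ c)]
    ring
  rw [h1, Fintype.sum_pow, mul_sum]
  refine Finset.sum_congr rfl fun κ _ => ?_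
  rw [Fin.prod_univ_succ, Finset.prod_ite_zero]
  have h2 : IsProper (SimpleGraph.starGraph (0 : Fin (k + 1))) (Fin.cons c κ : Fin (k + 1) → C) ↔
      ∀ i ∈ (univ : Finset (Fin k)), κ i ≠ c := by
    constructor
    · intro h i _
      have := h i.succ 0 (by simp [SimpleGraph.starGraph_adj])
      simpa using this
    · intro h a b hab
      rw [SimpleGraph.starGraph_adj] at hab
      cases a using Fin.cases <;> cases b using Fin.cases <;> simp_all [eq_comm]
  simp only [h2]
  split_ifs <;> simp

/-- The contribution to the path on `n + 1` vertices of colourings whose first colour is `c`. -/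
noncomputable def pathSumFrom (x : C → R) : ℕ → C → R
  | 0, c => x c
  | n + 1, c => x c * ((∑ c', pathSumFrom x n c') - pathSumFrom x n c)

omit [Fintype C] in
theorem pathGraph_proper_cons {n : ℕ} (c : C) (κ : Fin (n + 1) → C) :
    IsProper (SimpleGraph.pathGraph (n + 2)) (Fin.cons c κ : Fin (n + 2) → C) ↔
      κ 0 ≠ c ∧ IsProper (SimpleGraph.pathGraph (n + 1)) κ := by
  simp only [IsProper, SimpleGraph.pathGraph_adj]
  constructor
  · intro h
    refine ⟨?_, fun a b hab => ?_⟩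
    · simpa using h (Fin.succ 0) 0 (by simp)
    · simpa using h a.succ b.succ (by simpa using hab)
  · rintro ⟨h0, h⟩ a b hab
    cases a using Fin.cases with
    | zero =>
      cases b using Fin.cases with
      | zero => simp at hab
      | succ b =>
        have : b = 0 := by
          apply Fin.ext
          simp at hab ⊢
          omega
        subst this
        simpa using h0.symm
    | succ a =>
      cases b using Fin.cases with
      | zero =>
        have : a = 0 := by
          apply Fin.ext
          simp at hab ⊢
          omega
        subst this
        simpa using h0
      | succ b =>
        simpa using h a b (by simpa using hab)

open Classical in
theorem pathSumFrom_eq (x : C → R) (n : ℕ) (c : C) :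
    pathSumFrom x n c = ∑ κ : Fin n → C,
      if IsProper (SimpleGraph.pathGraph (n + 1)) (Fin.cons c κ : Fin (n + 1) → C)
      then x c * ∏ i, x (κ i) else 0 := by
  induction n generalizing c with
  | zero =>
    simp [pathSumFrom, IsProper, SimpleGraph.pathGraph_adj]
  | succ n ih =>
    simp only [pathGraph_proper_cons]
    rw [sum_fin_succ_fun, pathSumFrom, ← Finset.sum_erase_add _ _ (mem_univ c),
      add_sub_cancel_right, mul_sum, ← Finset.filter_ne', sum_filter]
    refine Finset.sum_congr rfl fun c' _ => ?_
    split_ifs with hc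
    · rw [ih, mul_sum]
      refine Finset.sum_congr rfl fun κ _ => ?_
      rw [mul_ite, mul_zero, Fin.prod_univ_succ]
      simp [hc]
    · simp [hc]

theorem colorSum_pathGraph_succ (x : C → R) (n : ℕ) :
    colorSum (SimpleGraph.pathGraph (n + 1)) x = ∑ c, pathSumFrom x n c := by
  classical
  unfold colorSum
  rw [sum_fin_succ_fun]
  refine Finset.sum_congr rfl fun c _ => ?_
  convert (pathSumFrom_eq x n c).symm using 4
  simp [Fin.prod_univ_succ]

end FiniteColours

section GeneratingFunction

variable {C R : Type*} [Fintype C] [CommRing R]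

/-- The inverse of `1 + t X`. -/
noncomputable def geomInv (t : R) : PowerSeries R := PowerSeries.mk fun k => (-t) ^ k

theorem geomInv_eq_rescale (t : R) :
    geomInv t = PowerSeries.rescale (-t) (PowerSeries.mk 1) := by
  ext k
  simp [geomInv, PowerSeries.coeff_rescale]

theorem geomInv_mul (t : R) : geomInv t * (1 + PowerSeries.C t * PowerSeries.X) = 1 := by
  have h := congrArg (PowerSeries.rescale (-t)) (PowerSeries.mk_one_mul_one_sub_eq_one R)
  rw [map_mul, ← geomInv_eq_rescale, map_sub, map_one, PowerSeries.rescale_X, map_neg] at h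
  linear_combination h

theorem coeff_geomInv_pow_succ (t : R) (b m : ℕ) :
    PowerSeries.coeff m (geomInv t ^ (b + 1)) = (-t) ^ m * ((b + m).choose m : R) := by
  rw [geomInv_eq_rescale, ← map_pow, PowerSeries.mk_one_pow_eq_mk_choose_add,
    PowerSeries.coeff_rescale, PowerSeries.coeff_mk, Nat.choose_symm_add]

/-- The generating function `∑_n X_{P_n} z^n`, for finitely many colours. -/
noncomputable def pathSeries (x : C → R) : PowerSeries R :=
  PowerSeries.mk fun n => colorSum (SimpleGraph.pathGraph n) x

theorem colorSum_pathGraph_zero (x : C → R) :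
    colorSum (SimpleGraph.pathGraph 0) x = 1 := by
  simp [colorSum, IsProper]

theorem pathSeries_mul (x : C → R) :
    pathSeries x * (1 - ∑ c, PowerSeries.C (x c) * PowerSeries.X * geomInv (x c)) = 1 := by
  classical
  let Q : C → PowerSeries R := fun c => PowerSeries.mk fun n => pathSumFrom x n c
  have h1 : pathSeries x = 1 + ∑ c, PowerSeries.X * Q c := by
    ext n
    cases n with
    | zero => simp [pathSeries, colorSum_pathGraph_zero]
    | succ n =>
      simp [pathSeries, colorSum_pathGraph_succ, PowerSeries.coeff_succ_X_mul, Q,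
        PowerSeries.coeff_one]
  have h2 : ∀ c, Q c = PowerSeries.C (x c) * (pathSeries x - PowerSeries.X * Q c) := by
    intro c
    ext n
    rw [PowerSeries.coeff_C_mul]
    cases n with
    | zero => simp [pathSeries, colorSum_pathGraph_zero, Q, pathSumFrom]
    | succ n =>
      simp [pathSeries, colorSum_pathGraph_succ, PowerSeries.coeff_succ_X_mul, Q, pathSumFrom]
  have h3 : ∀ c, PowerSeries.X * Q c =
      pathSeries x * (PowerSeries.C (x c) * PowerSeries.X * geomInv (x c)) := by
    intro c
    linear_combination (PowerSeries.X * geomInv (x c)) * h2 c -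
      PowerSeries.X * Q c * geomInv_mul (x c)
  rw [mul_sub, mul_sum, ← Finset.sum_congr rfl (fun c _ => h3 c), h1]
  ring

/-- The chromatic sum of the star on `k + 1` vertices, for finitely many colours. -/
noncomputable def starSum (x : C → R) : ℕ → R
  | 0 => 1
  | k + 1 => colorSum (SimpleGraph.starGraph (0 : Fin (k + 1))) x

theorem starSum_succ (x : C → R) (k : ℕ) :
    starSum x (k + 1) = ∑ c, x c * ((∑ c, x c) - x c) ^ k := by
  classical
  exact colorSum_starGraph x k

theorem starSum_one (x : C → R) : starSum x 1 = ∑ c, x c := by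
  simp [starSum_succ]

theorem X_pow_dvd_sum_starSum_sub (x : C → R) (n : ℕ) :
    (PowerSeries.X : PowerSeries R) ^ (n + 1) ∣
      (∑ k ∈ Icc 1 n, PowerSeries.C (starSum x k) *
        (PowerSeries.X * geomInv (starSum x 1)) ^ k) -
      ∑ c, PowerSeries.C (x c) * PowerSeries.X * geomInv (x c) := by
  set t := starSum x 1 with ht
  set w := PowerSeries.X * geomInv t with hw
  have hsum : (∑ k ∈ Icc 1 n, PowerSeries.C (starSum x k) * w ^ k) =
      ∑ c, PowerSeries.C (x c) * w *
        ∑ k ∈ range n, (PowerSeries.C (t - x c) * w) ^ k := by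
    rw [← Finset.Ico_add_one_right_eq_Icc, Finset.sum_Ico_eq_sum_range, Nat.add_sub_cancel]
    simp only [mul_sum]
    rw [Finset.sum_comm]
    refine Finset.sum_congr rfl fun k _ => ?_
    rw [Nat.add_comm 1 k, starSum_succ, ← starSum_one x, map_sum, sum_mul]
    refine Finset.sum_congr rfl fun c _ => ?_
    rw [map_mul, map_pow]
    ring
  rw [hsum, ← Finset.sum_sub_distrib]
  refine Finset.dvd_sum fun c _ => ?_
  set y := PowerSeries.C (t - x c) * w with hy
  have hgeo := geom_sum_mul y n
  have ht1 := geomInv_mul t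
  have hx1 := geomInv_mul (x c)
  have hy1 : (1 - y) * (1 + PowerSeries.C t * PowerSeries.X) =
      1 + PowerSeries.C (x c) * PowerSeries.X := by
    rw [hy, hw, map_sub]
    linear_combination (-(PowerSeries.C t - PowerSeries.C (x c)) * PowerSeries.X) * ht1
  have hS : (∑ k ∈ range n, y ^ k) =
      (1 - y ^ n) * (1 + PowerSeries.C t * PowerSeries.X) * geomInv (x c) := by
    linear_combination (-(1 + PowerSeries.C t * PowerSeries.X) * geomInv (x c)) * hgeo
      + (-(∑ k ∈ range n, y ^ k)) * hx1 + (-(∑ k ∈ range n, y ^ k)) * geomInv (x c) * hy1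
  rw [hS]
  refine ⟨-(PowerSeries.C (x c) * geomInv (x c) * (PowerSeries.C (t - x c) * geomInv t) ^ n), ?_⟩
  have hyn : y ^ n = PowerSeries.X ^ n * (PowerSeries.C (t - x c) * geomInv t) ^ n := by
    rw [hy, hw, ← mul_pow]
    ring
  rw [hyn, hw]
  linear_combination (PowerSeries.C (x c) * PowerSeries.X * geomInv (x c) *
    (1 - PowerSeries.X ^ n * (PowerSeries.C (t - x c) * geomInv t) ^ n)) * ht1

theorem Icc_one_eq_insert {n : ℕ} (hn : 1 ≤ n) : Icc 1 n = insert 1 (Icc 2 n) := by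
  ext i
  simp only [mem_Icc, mem_insert]
  omega

theorem X_pow_dvd_pathSeries_sub (x : C → R) {n : ℕ} (hn : 1 ≤ n) :
    (PowerSeries.X : PowerSeries R) ^ (n + 1) ∣ pathSeries x -
      ∑ j ∈ range (n + 1), (1 + PowerSeries.C (starSum x 1) * PowerSeries.X) ^ (j + 1) *
        (∑ k ∈ Icc 2 n, PowerSeries.C (starSum x k) *
          (PowerSeries.X * geomInv (starSum x 1)) ^ k) ^ j := by
  obtain ⟨E, hE⟩ := X_pow_dvd_sum_starSum_sub x n
  rw [Icc_one_eq_insert hn, sum_insert (by simp)] at hE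
  have hP := pathSeries_mul x
  set t := starSum x 1 with ht
  set w := PowerSeries.X * geomInv t with hw
  set u := 1 + PowerSeries.C t * PowerSeries.X with hu
  set T := ∑ k ∈ Icc 2 n, PowerSeries.C (starSum x k) * w ^ k with hT
  set A := ∑ c, PowerSeries.C (x c) * PowerSeries.X * geomInv (x c) with hA
  set P := pathSeries x with hPdef
  have ht1 : geomInv t * u = 1 := geomInv_mul t
  have h1 : P * (1 - u * T) = u - PowerSeries.X ^ (n + 1) * (u * P * E) := by
    have h0 : u * (1 - PowerSeries.C t * w) = 1 := by
      rw [hw]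
      linear_combination (-PowerSeries.C t * PowerSeries.X) * ht1
    linear_combination u * hP - u * P * hE - P * h0
  have hdvd : PowerSeries.X ∣ T := by
    refine Finset.dvd_sum fun k hk => ?_
    have hk0 : k ≠ 0 := by
      rw [mem_Icc] at hk
      omega
    exact Dvd.dvd.mul_left ((Dvd.intro _ rfl : PowerSeries.X ∣ w).trans (dvd_pow_self w hk0)) _
  obtain ⟨T', hT'⟩ := hdvd
  have hgeo := geom_sum_mul (u * T) (n + 1)
  have hsum : ∑ j ∈ range (n + 1), u ^ (j + 1) * T ^ j =
      u * ∑ j ∈ range (n + 1), (u * T) ^ j := by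
    rw [mul_sum]
    refine Finset.sum_congr rfl fun j _ => ?_
    rw [mul_pow]
    ring
  rw [hsum]
  have hpow : (u * T) ^ (n + 1) = PowerSeries.X ^ (n + 1) * (u * T') ^ (n + 1) := by
    rw [hT', ← mul_pow]
    ring
  set Γ := ∑ j ∈ range (n + 1), (u * T) ^ j with hΓ
  refine ⟨P * (u * T') ^ (n + 1) - u * P * E * Γ, ?_⟩
  linear_combination Γ * h1 + P * hgeo + P * hpow

end GeneratingFunction

section PathExpansion

variable {C R : Type*} [Fintype C] [CommRing R]

/-- The total `∑ i m_i` over parts of size at least two. -/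
def bigWeight (n : ℕ) (m : ℕ → ℕ) : ℕ := ∑ i ∈ Icc 2 n, i * m i

theorem coeff_pow_mul_X_mul_geomInv_pow (t : R) {n j N : ℕ} (hn : 2 ≤ n) (hj : 2 * j ≤ N)
    (hN : j = 0 → N = 0) (hNn : N ≤ n) :
    PowerSeries.coeff n ((1 + PowerSeries.C t * PowerSeries.X) ^ (j + 1) *
      (PowerSeries.X * geomInv t) ^ N) =
    (-1) ^ (n - N) * ((n - 2 - j).choose (n - N) : R) * t ^ (n - N) := by
  have ht1 := geomInv_mul t
  rcases Nat.eq_zero_or_pos j with rfl | hj0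
  · rw [hN rfl, Nat.choose_eq_zero_of_lt (by omega)]
    obtain ⟨m, rfl⟩ : ∃ m, n = m + 2 := ⟨n - 2, by omega⟩
    simp [PowerSeries.coeff_one]
  · obtain ⟨a, rfl⟩ : ∃ a, N = j + 1 + a := ⟨N - (j + 1), by omega⟩
    have h1 : (1 + PowerSeries.C t * PowerSeries.X) ^ (j + 1) *
        (PowerSeries.X * geomInv t) ^ (j + 1 + a) =
        PowerSeries.X ^ (j + 1 + a) * geomInv t ^ a := by
      calc _ = (geomInv t * (1 + PowerSeries.C t * PowerSeries.X)) ^ (j + 1) *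
            (PowerSeries.X ^ (j + 1 + a) * geomInv t ^ a) := by
            rw [mul_pow, mul_pow, pow_add (geomInv t)]
            ring
        _ = _ := by rw [ht1, one_pow, one_mul]
    rw [h1, PowerSeries.coeff_X_pow_mul', if_pos hNn]
    generalize hm : n - (j + 1 + a) = m
    cases a with
    | zero =>
      cases m with
      | zero => simp
      | succ m =>
        rw [Nat.choose_eq_zero_of_lt (by omega)]
        simp [PowerSeries.coeff_one]
    | succ b =>
      rw [coeff_geomInv_pow_succ, neg_pow]
      have : n - 2 - j = b + m := by omega
      rw [this]
      ring

theorem coeff_pow_mul_X_mul_geomInv_pow_of_lt (t : R) {n j N : ℕ} (hNn : n < N) :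
    PowerSeries.coeff n ((1 + PowerSeries.C t * PowerSeries.X) ^ (j + 1) *
      (PowerSeries.X * geomInv t) ^ N) = 0 := by
  rw [mul_pow, mul_left_comm, PowerSeries.coeff_X_pow_mul', if_neg (by omega)]

/-- The summand attached to the multiplicities `m_2, …, m_n`. -/
noncomputable def pathTerm (st : ℕ → R) (n : ℕ) (m : ℕ → ℕ) : R :=
  (-1) ^ (n - bigWeight n m) * (Nat.multinomial (Icc 2 n) m : R) *
    ((n - 2 - ∑ i ∈ Icc 2 n, m i).choose (n - bigWeight n m) : R) *
    (st 1 ^ (n - bigWeight n m) * ∏ i ∈ Icc 2 n, st i ^ m i)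

theorem colorSum_pathGraph_eq_sum_piAntidiag (x : C → R) {n : ℕ} (hn : 2 ≤ n) :
    colorSum (SimpleGraph.pathGraph n) x =
      ∑ j ∈ range (n + 1), ∑ m ∈ piAntidiag (Icc 2 n) j,
        if bigWeight n m ≤ n then pathTerm (starSum x) n m else 0 := by
  have h := PowerSeries.X_pow_dvd_iff.mp (X_pow_dvd_pathSeries_sub x (by omega : 1 ≤ n)) n
    (Nat.lt_succ_self n)
  rw [map_sub, sub_eq_zero, map_sum] at h
  refine (PowerSeries.coeff_mk n _).symm.trans (h.trans ?_)
  refine Finset.sum_congr rfl fun j _ => ?_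
  rw [Finset.sum_pow_eq_sum_piAntidiag, mul_sum, map_sum]
  refine Finset.sum_congr rfl fun m hm => ?_
  rw [mem_piAntidiag] at hm
  set t := starSum x 1 with ht
  have h1 : (1 + PowerSeries.C t * PowerSeries.X) ^ (j + 1) *
      ((Nat.multinomial (Icc 2 n) m : PowerSeries R) * ∏ k ∈ Icc 2 n,
        (PowerSeries.C (starSum x k) * (PowerSeries.X * geomInv t) ^ k) ^ m k) =
      PowerSeries.C ((Nat.multinomial (Icc 2 n) m : R) * ∏ k ∈ Icc 2 n, starSum x k ^ m k) *
      ((1 + PowerSeries.C t * PowerSeries.X) ^ (j + 1) *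
        (PowerSeries.X * geomInv t) ^ bigWeight n m) := by
    simp only [mul_pow _ (_ ^ _), ← pow_mul _ (_ : ℕ) (_ : ℕ)]
    rw [Finset.prod_mul_distrib, Finset.prod_pow_eq_pow_sum, bigWeight, map_mul, map_natCast,
      map_prod]
    simp only [map_pow]
    ring
  rw [h1, PowerSeries.coeff_C_mul]
  split_ifs with hN
  · have hj : 2 * j ≤ bigWeight n m := by
      rw [← hm.1, mul_sum]
      exact Finset.sum_le_sum fun i hi => Nat.mul_le_mul_right _ (mem_Icc.mp hi).1
    have hz : j = 0 → bigWeight n m = 0 := by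
      intro hj0
      refine Finset.sum_eq_zero fun i hi => ?_
      have := hm.1
      rw [hj0, Finset.sum_eq_zero_iff] at this
      rw [this i hi, mul_zero]
    rw [coeff_pow_mul_X_mul_geomInv_pow t hn hj hz hN, pathTerm, hm.1]
    ring
  · rw [coeff_pow_mul_X_mul_geomInv_pow_of_lt t (by omega), mul_zero]

@[to_additive]
theorem prod_map_parts {M : Type*} [CommMonoid M] {n : ℕ} (hn : 1 ≤ n) (p : n.Partition)
    (f : ℕ → M) :
    (p.parts.map f).prod = f 1 ^ mult p 1 * ∏ i ∈ Icc 2 n, f i ^ mult p i := by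
  rw [Finset.prod_multiset_map_count, ← Finset.prod_insert (f := fun i => f i ^ mult p i)
    (by simp), ← Icc_one_eq_insert hn]
  refine Finset.prod_subset (fun i hi => ?_) (fun i _ hi => ?_)
  · rw [Multiset.mem_toFinset] at hi
    rw [mem_Icc]
    exact ⟨p.parts_pos hi, (Multiset.le_sum_of_mem hi).trans_eq p.parts_sum⟩
  · rw [Multiset.mem_toFinset] at hi
    rw [Multiset.count_eq_zero_of_notMem hi, pow_zero]

theorem mult_one_add_bigWeight {n : ℕ} (hn : 1 ≤ n) (p : n.Partition) :
    mult p 1 + bigWeight n (mult p) = n := by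
  have h := sum_map_parts hn p (fun i => i)
  rw [Multiset.map_id', p.parts_sum] at h
  simpa [bigWeight, mul_comm] using h.symm

theorem len_eq {n : ℕ} (hn : 1 ≤ n) (p : n.Partition) :
    len p = mult p 1 + ∑ i ∈ Icc 2 n, mult p i := by
  have h := sum_map_parts hn p (fun _ => (1 : ℕ))
  simpa [len] using h

/-- The multiplicities of the parts of size at least two. -/
def bigMult {n : ℕ} (p : n.Partition) (i : ℕ) : ℕ := if i ∈ Icc 2 n then mult p i else 0

theorem bigMult_of_mem {n : ℕ} (p : n.Partition) {i : ℕ} (hi : i ∈ Icc 2 n) :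
    bigMult p i = mult p i := if_pos hi

theorem bigWeight_bigMult {n : ℕ} (p : n.Partition) :
    bigWeight n (bigMult p) = bigWeight n (mult p) :=
  Finset.sum_congr rfl fun i hi => by rw [bigMult_of_mem p hi]

theorem bigMult_injective {n : ℕ} (hn : 1 ≤ n) :
    Function.Injective (bigMult : n.Partition → ℕ → ℕ) := by
  intro p q h
  have hmem : ∀ i ∈ Icc 2 n, mult p i = mult q i := fun i hi => by
    rw [← bigMult_of_mem p hi, h, bigMult_of_mem q hi]
  have hw : bigWeight n (mult p) = bigWeight n (mult q) := by
    rw [← bigWeight_bigMult, h, bigWeight_bigMult]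
  have h1 : mult p 1 = mult q 1 := by
    have hp := mult_one_add_bigWeight hn p
    have hq := mult_one_add_bigWeight hn q
    omega
  have hout : ∀ (r : n.Partition) (i : ℕ), i ∉ Icc 1 n → mult r i = 0 := by
    intro r i hi
    refine Multiset.count_eq_zero_of_notMem fun hr => hi ?_
    rw [mem_Icc]
    exact ⟨r.parts_pos hr, (Multiset.le_sum_of_mem hr).trans_eq r.parts_sum⟩
  apply Nat.Partition.ext
  ext i
  change mult p i = mult q i
  by_cases hi : i ∈ Icc 1 n
  · rw [Icc_one_eq_insert hn, mem_insert] at hi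
    rcases hi with rfl | hi
    · exact h1
    · exact hmem i hi
  · rw [hout p i hi, hout q i hi]

theorem exists_bigMult_eq {n : ℕ} {m : ℕ → ℕ} (hm : ∀ i, m i ≠ 0 → i ∈ Icc 2 n)
    (hw : bigWeight n m ≤ n) : ∃ p : n.Partition, bigMult p = m := by
  let s : Multiset ℕ := Multiset.replicate (n - bigWeight n m) 1 +
    ∑ i ∈ Icc 2 n, Multiset.replicate (m i) i
  refine ⟨⟨s, ?_, ?_⟩, ?_⟩
  · intro i hi
    rw [Multiset.mem_add, Multiset.mem_sum] at hi
    rcases hi with hi | ⟨k, hk, hi⟩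
    · rw [Multiset.eq_of_mem_replicate hi]
      exact one_pos
    · rw [Multiset.eq_of_mem_replicate hi]
      rw [mem_Icc] at hk
      omega
  · rw [Multiset.sum_add, ← Multiset.coe_sumAddMonoidHom, map_sum]
    simp only [Multiset.coe_sumAddMonoidHom, Multiset.sum_replicate, smul_eq_mul, mul_one]
    rw [Finset.sum_congr rfl fun i _ => mul_comm (m i) i]
    exact Nat.sub_add_cancel hw
  · funext i
    by_cases hi : i ∈ Icc 2 n
    · rw [bigMult_of_mem _ hi]
      change Multiset.count i s = m i
      rw [Multiset.count_add, Multiset.count_sum', Multiset.count_replicate,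
        if_neg (by rw [mem_Icc] at hi; omega), zero_add]
      simp only [Multiset.count_replicate]
      rw [Finset.sum_ite_eq' _ i m, if_pos hi]
    · rw [bigMult, if_neg hi]
      by_contra h
      exact hi (hm i (Ne.symm h))

theorem colorSum_pathGraph_eq_sum_partition (x : C → R) {n : ℕ} (hn : 4 ≤ n) :
    colorSum (SimpleGraph.pathGraph n) x =
      ∑ p : n.Partition, (-1) ^ mult p 1 * (Nat.multinomial (Icc 2 n) (mult p) : R) *
        ((n + mult p 1 - 2 - len p).choose (mult p 1) : R) *
        (p.parts.map (starSum x)).prod := by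
  rw [colorSum_pathGraph_eq_sum_piAntidiag x (by omega), Finset.sum_sigma']
  symm
  refine Finset.sum_of_injOn
    (fun p => (⟨∑ i ∈ Icc 2 n, bigMult p i, bigMult p⟩ : Σ _ : ℕ, ℕ → ℕ)) ?_ ?_ ?_ ?_
  · intro p _ q _ h
    exact bigMult_injective (by omega) (eq_of_heq (Sigma.mk.inj h).2)
  · intro p _
    have hw := mult_one_add_bigWeight (by omega) p
    simp only [coe_sigma, Set.mem_sigma_iff, mem_coe, mem_range, mem_piAntidiag, true_and]
    refine ⟨?_, fun i hi => ?_⟩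
    · have : ∑ i ∈ Icc 2 n, bigMult p i ≤ bigWeight n (bigMult p) :=
        Finset.sum_le_sum fun i hi => Nat.le_mul_of_pos_left _ (by rw [mem_Icc] at hi; omega)
      rw [bigWeight_bigMult] at this
      omega
    · by_contra h
      exact hi (if_neg h)
  · rintro ⟨j, m⟩ hjm hne
    rw [mem_sigma, mem_piAntidiag] at hjm
    refine if_neg fun hw => hne ?_
    obtain ⟨p, hp⟩ := exists_bigMult_eq hjm.2.2 hw
    refine ⟨p, mem_coe.mpr (mem_univ p), ?_⟩
    dsimp only at hjm ⊢
    rw [hp, hjm.2.1]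
  · intro p _
    have hw := mult_one_add_bigWeight (by omega) p
    have hl := len_eq (by omega) p
    have hs : ∑ i ∈ Icc 2 n, bigMult p i = ∑ i ∈ Icc 2 n, mult p i :=
      Finset.sum_congr rfl fun i hi => bigMult_of_mem p hi
    have hp : ∏ i ∈ Icc 2 n, starSum x i ^ bigMult p i = ∏ i ∈ Icc 2 n, starSum x i ^ mult p i :=
      Finset.prod_congr rfl fun i hi => by rw [bigMult_of_mem p hi]
    have hmul : Nat.multinomial (Icc 2 n) (bigMult p) = Nat.multinomial (Icc 2 n) (mult p) :=
      Nat.multinomial_congr fun i hi => bigMult_of_mem p hi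
    dsimp only
    rw [if_pos (by rw [bigWeight_bigMult]; omega), pathTerm, bigWeight_bigMult, hs, hp, hmul,
      prod_map_parts (by omega)]
    have e1 : n - bigWeight n (mult p) = mult p 1 := by omega
    have e2 : n - 2 - ∑ i ∈ Icc 2 n, mult p i =
        n + mult p 1 - 2 - len p := by omega
    rw [e1, e2]

end PathExpansion

theorem starCsf_sub_starSum_mem (N k : ℕ) :
    starCsf k - starSum (fun i : Fin N => (MvPowerSeries.X (i : ℕ) : Series)) k ∈ tailIdeal N := by
  cases k with
  | zero => simp [starCsf, starSum]
  | succ k => exact csf_sub_colorSum_mem _ N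

end ChromaticSymm

open ChromaticSymm in
theorem mainTheorem9 (n : ℕ) (hn : 4 ≤ n) :
    ChromaticSymm.csf (SimpleGraph.pathGraph n) =
      ∑ p : n.Partition,
        ((-1 : ℚ) ^ ChromaticSymm.mult p 1 *
          (Nat.multinomial (Finset.Icc 2 n) (ChromaticSymm.mult p) : ℚ) *
          (Nat.choose (n + ChromaticSymm.mult p 1 - 2 - ChromaticSymm.len p)
            (ChromaticSymm.mult p 1) : ℚ)) •
          ChromaticSymm.starBasis p := by
  refine eq_of_sub_mem_tailIdeal fun N => ?_
  rw [← Ideal.Quotient.eq]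
  have hpath := csf_sub_colorSum_mem (SimpleGraph.pathGraph n) N
  rw [← Ideal.Quotient.eq] at hpath
  rw [hpath, colorSum_pathGraph_eq_sum_partition _ hn, map_sum, map_sum]
  refine Finset.sum_congr rfl fun p _ => ?_
  have hstar : Ideal.Quotient.mk (tailIdeal N)
      (p.parts.map (starSum fun i : Fin N => (MvPowerSeries.X (i : ℕ) : Series))).prod =
      Ideal.Quotient.mk (tailIdeal N) (starBasis p) := by
    rw [starBasis, map_multiset_prod, map_multiset_prod, Multiset.map_map, Multiset.map_map]
    refine congrArg _ (Multiset.map_congr rfl fun k _ => ?_)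
    exact (Ideal.Quotient.eq.mpr (starCsf_sub_starSum_mem N k)).symm
  rw [map_mul, hstar, ← map_mul, Algebra.smul_def]
  simp only [map_mul, map_pow, map_neg, map_one, map_natCast]
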